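/- Let $H$ be a self-adjoint operator on a separable complex Hilbert space $\mathcal H$, bounded from below, and let $c\in\mathbb R$ be any number with $H\ge -c$, i.e. $(x,Hx)\ge -c\|x\|^2$ for all $x\in D(H)$. Let $\mathcal Q(H)=D((H+c)^{1/2})$ be the form domain of $H$, and let $P$ be an orthogonal projection on $\mathcal H$ of finite rank with $P\mathcal H\subset\mathcal Q(H)$. Define $$H_P := \big((H+c)^{1/2}P\big)^*\big((H+c)^{1/2}P\big) - cP ,$$ which for $H\ge 0$ and $c=0$ is $(H^{1/2}P)^*(H^{1/2}P)$ (neither $\mathcal Q(H)$ nor $H_P$ depends on the choice of $c$). Then for every $\psi\in\mathcal H$ and every $t\ge 0$, $$\lim_{n\to\infty}\big(P\,e^{-iHt/n}\,P\big)^n\psi = e^{-iH_Pt}P\psi ,$$ and the convergence is uniform in $t$ on every compact interval contained in $[0,\infty)$. Here $e^{-iAt}$ denotes the strongly continuous one-parameter unitary group with generator $-iA$. -/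

import Mathlib

open Filter Topology

noncomputable section

namespace ZenoDynamics

variable {E : Type*} [NormedAddCommGroup E] [InnerProductSpace ℂ E]

/-- The product `B A` of two unbounded operators, on its natural domain
`{x ∈ D(A) : A x ∈ D(B)}`. -/
def opComp (B A : E →ₗ.[ℂ] E) : E →ₗ.[ℂ] E where
  domain :=
    { carrier := {x | ∃ h : x ∈ A.domain, A ⟨x, h⟩ ∈ B.domain}
      zero_mem' := ⟨A.domain.zero_mem, by
        have h0 : A ⟨0, A.domain.zero_mem⟩ = 0 := A.map_zero
        rw [h0]
        exact B.domain.zero_mem⟩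
      add_mem' := by
        rintro x y ⟨hx, hx'⟩ ⟨hy, hy'⟩
        refine ⟨A.domain.add_mem hx hy, ?_⟩
        have h := A.map_add ⟨x, hx⟩ ⟨y, hy⟩
        have h2 : A ⟨x + y, A.domain.add_mem hx hy⟩ = A ⟨x, hx⟩ + A ⟨y, hy⟩ := h
        rw [h2]
        exact B.domain.add_mem hx' hy'
      smul_mem' := by
        rintro c x ⟨hx, hx'⟩
        refine ⟨A.domain.smul_mem c hx, ?_⟩
        have h : A ⟨c • x, A.domain.smul_mem c hx⟩ = c • A ⟨x, hx⟩ := A.map_smul c ⟨x, hx⟩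
        rw [h]
        exact B.domain.smul_mem c hx' }
  toFun :=
    { toFun := fun x => B ⟨A ⟨x.1, x.2.1⟩, x.2.2⟩
      map_add' := by
        intro x y
        rw [← B.map_add]
        congr 1
        exact Subtype.ext (A.map_add ⟨x.1, x.2.1⟩ ⟨y.1, y.2.1⟩)
      map_smul' := by
        intro c x
        rw [RingHom.id_apply, ← B.map_smul]
        congr 1
        exact Subtype.ext (A.map_smul c ⟨x.1, x.2.1⟩) }

/-- The operator `A + c`, on the domain of `A`. -/
def shift (c : ℝ) (A : E →ₗ.[ℂ] E) : E →ₗ.[ℂ] E :=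
  ((c : ℂ) • (LinearMap.id : E →ₗ[ℂ] E)) +ᵥ A

/-- `A ≥ -c` in the sense of quadratic forms: `⟨x, A x⟩ ≥ -c ‖x‖²` on the domain of `A`. -/
def IsBoundedBelow (A : E →ₗ.[ℂ] E) (c : ℝ) : Prop :=
  ∀ x : A.domain, -c * ‖(x : E)‖ ^ 2 ≤ (inner ℂ (x : E) (A x)).re

variable [CompleteSpace E]

/-- `S` is the positive square root of `A`: self-adjoint, nonnegative, and `S S = A`
(with equality of domains). -/
structure IsPositiveSqrt (A S : E →ₗ.[ℂ] E) : Prop where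
  selfAdjoint : IsSelfAdjoint S
  nonneg : ∀ x : S.domain, 0 ≤ (inner ℂ (x : E) (S x)).re
  sq : opComp S S = A

open Classical in
/-- The positive square root `A^{1/2}`. It exists and is unique for every nonnegative
self-adjoint `A`; the value is the trivial operator with domain `{0}` if there is none. -/
def sqrtOp (A : E →ₗ.[ℂ] E) : E →ₗ.[ℂ] E :=
  if h : ∃ S, IsPositiveSqrt A S then h.choose else ⊥

/-- `U` is the strongly continuous one-parameter unitary group whose infinitesimal
generator is exactly `-i A` (with equality of domains). -/
structure IsUnitaryGroupOf (A : E →ₗ.[ℂ] E) (U : ℝ → E →L[ℂ] E) : Prop where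
  mem_unitary : ∀ t, U t ∈ unitary (E →L[ℂ] E)
  map_zero : U 0 = 1
  map_add : ∀ s t, U (s + t) = U s * U t
  continuous : ∀ x, Continuous fun t => U t x
  mem_graph_iff : ∀ x y : E,
    (x, y) ∈ A.graph ↔ HasDerivAt (fun t => U t x) (-Complex.I • y) 0

open Classical in
/-- The group `t ↦ e^{-i A t}`. By Stone's theorem it exists and is unique for every
self-adjoint `A`; the value is `0` if there is none. -/
def expNegI (A : E →ₗ.[ℂ] E) : ℝ → E →L[ℂ] E :=
  if h : ∃ U, IsUnitaryGroupOf A U then h.choose else 0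

/-- The form domain `Q(H) = D((H + c)^{1/2})` of a self-adjoint operator `H ≥ -c`
(it does not depend on the choice of such a `c`). -/
def formDomain (H : E →ₗ.[ℂ] E) (c : ℝ) : Submodule ℂ E :=
  (sqrtOp (shift c H)).domain

/-- The operator `(H + c)^{1/2} P`, on its natural domain. -/
def sqrtComp (H : E →ₗ.[ℂ] E) (c : ℝ) (P : E →L[ℂ] E) : E →ₗ.[ℂ] E :=
  opComp (sqrtOp (shift c H)) ((P : E →ₗ[ℂ] E).toPMap ⊤)

/-- The generator of the Zeno dynamics for `H ≥ -c`,
`H_P = ((H + c)^{1/2} P)^* ((H + c)^{1/2} P) - c P`,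
which is the operator associated with the quadratic form `u ↦ h[P u]`, `h` being the form of `H`
(so it does not depend on the choice of `c`).
For `c = 0`, that is `H ≥ 0`, this is `(H^{1/2} P)^* (H^{1/2} P)`. -/
def zenoGenerator (H : E →ₗ.[ℂ] E) (c : ℝ) (P : E →L[ℂ] E) : E →ₗ.[ℂ] E :=
  (-((c : ℂ) • (P : E →ₗ[ℂ] E))) +ᵥ opComp (sqrtComp H c P).adjoint (sqrtComp H c P)

end ZenoDynamics

end

/-! ### Graphs of unbounded operators and the resolvent of a nonnegative operator. -/

namespace ZenoDynamics

variable {E : Type*} [NormedAddCommGroup E] [InnerProductSpace ℂ E]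

/-! Put `A = H + c ≥ 0`, `R = (A + 1)⁻¹` and `V t = e^{-iAt}`. The range of `P` is
finite-dimensional and lies in `D(A^{1/2}) = ran R^{1/2}`, so `P = R^{1/2} D` with `D` bounded. As
`V t` commutes with `R`, `P (V t) P = D* (V t) R D`. The range of `R` is `D(A)`, so this is strongly
differentiable at 0 although `ran P` need not lie in `D(H)`; the derivative is `-i M* M` with `M =
(1 - R)^{1/2} D = A^{1/2} P` (`hasDerivAt_compression`). Undoing the shift by `c`, `F t = P e^{-iHt}
P` has derivative `-i (M* M - c P) = -i H_P` at 0, and `H_P` is bounded (`zenoGenerator_eq`).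

Hence `F` and `G t = e^{-i H_P t}` agree to first order on `ran P`, in operator norm by finite
dimension (`eventually_norm_compression_sub_le`). Telescoping `F(t/n)^n - G(t/n)^n` costs a factor
`n` against an error `o(t/n)`, which gives the limit, uniformly on compacta
(`tendstoUniformlyOn_pow`).

Square root and group are built from `R` by the continuous functional calculus. `sqrtOp` is an
arbitrary choice, so uniqueness of the square root is proved too; for `expNegI` the defining
properties of any group with that generator suffice. -/

theorem mem_graph_opComp {B A : E →ₗ.[ℂ] E} {x z : E} :
    (x, z) ∈ (opComp B A).graph ↔ ∃ y, (x, y) ∈ A.graph ∧ (y, z) ∈ B.graph := by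
  simp only [LinearPMap.mem_graph_iff]
  constructor
  · rintro ⟨⟨_, h, h'⟩, rfl, rfl⟩
    exact ⟨_, ⟨⟨_, h⟩, rfl, rfl⟩, ⟨_, h'⟩, rfl, rfl⟩
  · rintro ⟨_, ⟨⟨_, h⟩, rfl, rfl⟩, ⟨⟨_, h'⟩, rfl, rfl⟩⟩
    exact ⟨⟨_, h, h'⟩, rfl, rfl⟩

theorem mem_graph_vadd {T : E →ₗ[ℂ] E} {A : E →ₗ.[ℂ] E} {x y : E} :
    (x, y) ∈ (T +ᵥ A).graph ↔ (x, y - T x) ∈ A.graph := by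
  simp only [LinearPMap.mem_graph_iff]
  constructor
  · rintro ⟨⟨_, h⟩, rfl, rfl⟩
    exact ⟨⟨_, h⟩, rfl, by simp [LinearPMap.vadd_apply]⟩
  · rintro ⟨⟨_, h⟩, rfl, h'⟩
    exact ⟨⟨_, h⟩, rfl, by simp [LinearPMap.vadd_apply, h']⟩

theorem mem_graph_shift {c : ℝ} {A : E →ₗ.[ℂ] E} {x y : E} :
    (x, y) ∈ (shift c A).graph ↔ (x, y - (c : ℂ) • x) ∈ A.graph := by
  rw [shift, mem_graph_vadd]
  rfl

theorem mem_graph_toPMap_top {T : E →ₗ[ℂ] E} {x y : E} :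
    (x, y) ∈ (T.toPMap ⊤).graph ↔ T x = y := by
  simp [LinearPMap.mem_graph_iff]

theorem shift_nonneg {A : E →ₗ.[ℂ] E} {c : ℝ} (h : IsBoundedBelow A c) {x y : E}
    (hxy : (x, y) ∈ (shift c A).graph) : 0 ≤ (inner ℂ x y).re := by
  rw [mem_graph_shift, LinearPMap.mem_graph_iff] at hxy
  obtain ⟨z, rfl, hz⟩ := hxy
  have := h z
  dsimp only at hz
  have h1 : (inner ℂ (z : E) (z : E)).re = ‖(z : E)‖ ^ 2 := inner_self_eq_norm_sq (𝕜 := ℂ) (z : E)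
  rw [hz, inner_sub_right, inner_smul_right, Complex.sub_re, Complex.re_ofReal_mul, h1] at this
  linarith

/-- The operator `R` is the resolvent `(A + 1)⁻¹`, with `0 ≤ R ≤ 1`. -/
structure IsPosResolvent (A : E →ₗ.[ℂ] E) (R : E →L[ℂ] E) : Prop where
  isPositive : R.IsPositive
  isPositive_one_sub : (1 - R).IsPositive
  mem_graph_iff : ∀ x y, (x, y) ∈ A.graph ↔ R (x + y) = x

namespace IsPosResolvent

variable {A : E →ₗ.[ℂ] E} {R : E →L[ℂ] E}

theorem injective (h : IsPosResolvent A R) : Function.Injective R := by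
  rw [injective_iff_map_eq_zero]
  intro y hy
  have : ((0 : E), y) ∈ A.graph := (h.mem_graph_iff _ _).2 (by simpa using hy)
  exact A.graph_fst_eq_zero_snd this rfl

theorem nonneg (h : IsPosResolvent A R) : 0 ≤ R :=
  (ContinuousLinearMap.nonneg_iff_isPositive R).2 h.isPositive

theorem nonneg_one_sub (h : IsPosResolvent A R) : 0 ≤ 1 - R :=
  (ContinuousLinearMap.nonneg_iff_isPositive _).2 h.isPositive_one_sub

theorem apply_mem_graph (h : IsPosResolvent A R) (x : E) : (R x, (1 - R) x) ∈ A.graph :=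
  (h.mem_graph_iff _ _).2 (by simp)

end IsPosResolvent

section Complete

variable [CompleteSpace E]

theorem isSelfAdjoint_iff_mem_graph {A : E →ₗ.[ℂ] E} (hA : Dense (A.domain : Set E)) :
    IsSelfAdjoint A ↔ ∀ x y, (x, y) ∈ A.graph ↔
      ∀ a b, (a, b) ∈ A.graph → inner ℂ b x = inner ℂ a y := by
  rw [LinearPMap.isSelfAdjoint_def]
  have key := LinearPMap.adjoint_graph_eq_graph_adjoint hA
  constructor
  · intro h x y
    rw [h] at key
    conv_lhs => rw [key]
    simp [sub_eq_zero]
  · intro h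
    apply LinearPMap.eq_of_eq_graph
    rw [key]
    ext ⟨x, y⟩
    rw [h]
    simp [sub_eq_zero]

theorem _root_.IsSelfAdjoint.mem_graph_iff {A : E →ₗ.[ℂ] E} (hA : IsSelfAdjoint A) (x y : E) :
    (x, y) ∈ A.graph ↔ ∀ a b, (a, b) ∈ A.graph → inner ℂ b x = inner ℂ a y :=
  (isSelfAdjoint_iff_mem_graph hA.dense_domain).1 hA x y

theorem _root_.IsSelfAdjoint.inner_eq {A : E →ₗ.[ℂ] E} (hA : IsSelfAdjoint A) {x y a b : E}
    (h : (x, y) ∈ A.graph) (h' : (a, b) ∈ A.graph) : inner ℂ b x = inner ℂ a y :=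
  (hA.mem_graph_iff x y).1 h a b h'

theorem isSelfAdjoint_shift {A : E →ₗ.[ℂ] E} (hA : IsSelfAdjoint A) (c : ℝ) :
    IsSelfAdjoint (shift c A) := by
  rw [isSelfAdjoint_iff_mem_graph (by exact hA.dense_domain)]
  intro x y
  rw [mem_graph_shift, hA.mem_graph_iff]
  constructor
  · intro h a b hab
    have := h _ _ (mem_graph_shift.1 hab)
    simpa [inner_sub_left, inner_sub_right, inner_smul_left, inner_smul_right] using this
  · intro h a b hab
    have := h a (b + (c : ℂ) • a) (mem_graph_shift.2 (by simpa using hab))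
    simp only [inner_add_left, inner_smul_left, Complex.conj_ofReal] at this
    rw [inner_sub_right, inner_smul_right, ← this]
    ring

/-- Nonnegativity gives `‖x‖ ≤ ‖x + A x‖`, so `A + 1`, viewed as a map on the closed graph of `A`,
is injective with closed range. Self-adjointness makes the range dense. -/
theorem exists_isPosResolvent {A : E →ₗ.[ℂ] E} (hA : IsSelfAdjoint A)
    (h0 : ∀ x y, (x, y) ∈ A.graph → 0 ≤ (inner ℂ x y).re) :
    ∃ R, IsPosResolvent A R := by
  have hbound : ∀ x y, (x, y) ∈ A.graph → ‖x‖ ≤ ‖x + y‖ := by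
    intro x y hxy
    rcases eq_or_ne x 0 with rfl | hx
    · simp
    have h1 : ‖x‖ * ‖x‖ ≤ ‖x‖ * ‖x + y‖ := by
      refine le_trans ?_ (re_inner_le_norm (𝕜 := ℂ) x (x + y))
      have := h0 x y hxy
      rw [inner_add_right, map_add, inner_self_eq_norm_mul_norm]
      exact le_add_of_nonneg_right this
    exact le_of_mul_le_mul_left h1 (norm_pos_iff.2 hx)
  let φ : A.graph →L[ℂ] E :=
    (ContinuousLinearMap.fst ℂ E E + ContinuousLinearMap.snd ℂ E E).comp A.graph.subtypeL
  have hφ : ∀ p : A.graph, φ p = p.1.1 + p.1.2 := fun p => rfl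
  have hcl : IsClosed (A.graph : Set (E × E)) := hA.isClosed
  have : CompleteSpace A.graph := hcl.completeSpace_coe
  have hanti : AntilipschitzWith 2 φ := by
    refine AddMonoidHomClass.antilipschitz_of_bound φ fun p => ?_
    have h1 := hbound p.1.1 p.1.2 p.2
    have h2 : ‖p.1.2‖ ≤ ‖p.1.1 + p.1.2‖ + ‖p.1.1‖ := by
      simpa using norm_sub_le (p.1.1 + p.1.2) p.1.1
    rw [hφ]
    have h3 : ‖p‖ = max ‖p.1.1‖ ‖p.1.2‖ := rfl
    have := norm_nonneg p.1.1
    rw [h3]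
    refine max_le ?_ ?_ <;> push_cast <;> linarith
  have hclr : IsClosed (Set.range φ) := hanti.isClosed_range φ.uniformContinuous
  have htop : (LinearMap.range (φ : A.graph →ₗ[ℂ] E)) = ⊤ := by
    have hc : IsClosed ((LinearMap.range (φ : A.graph →ₗ[ℂ] E) : Submodule ℂ E) : Set E) := by
      exact hclr
    have := hc.completeSpace_coe
    rw [← Submodule.orthogonal_eq_bot_iff, Submodule.eq_bot_iff]
    intro y hy
    rw [Submodule.mem_orthogonal] at hy
    -- A vector orthogonal to the range satisfies `A y = -y`, so the bound forces `y = 0`.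
    have hm : (y, -y) ∈ A.graph := by
      rw [hA.mem_graph_iff]
      intro a b hab
      have := hy (a + b) ⟨⟨(a, b), hab⟩, rfl⟩
      rw [inner_add_left] at this
      rw [inner_neg_right]
      linear_combination this
    have := hbound _ _ hm
    simpa using this
  have hsurj : ∀ z, ∃ p : A.graph, φ p = z := fun z => by
    have : z ∈ LinearMap.range (φ : A.graph →ₗ[ℂ] E) := htop ▸ Submodule.mem_top
    exact this
  let e : A.graph ≃ₗ[ℂ] E :=
    LinearEquiv.ofBijective (φ : A.graph →ₗ[ℂ] E) ⟨hanti.injective, hsurj⟩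
  have he : ∀ p : A.graph, e p = p.1.1 + p.1.2 := fun p => rfl
  let R₀ : E →ₗ[ℂ] E := (LinearMap.fst ℂ E E ∘ₗ A.graph.subtype) ∘ₗ e.symm.toLinearMap
  have hR₀ : ∀ z, R₀ z = (e.symm z).1.1 := fun z => rfl
  let R : E →L[ℂ] E := R₀.mkContinuous 1 fun z => by
    rw [hR₀, one_mul]
    conv_rhs => rw [← e.apply_symm_apply z, he]
    exact hbound _ _ (e.symm z).2
  have hR : ∀ p : A.graph, R (p.1.1 + p.1.2) = p.1.1 := fun p => by
    change R₀ _ = _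
    rw [hR₀, ← he, e.symm_apply_apply]
  have hgr : ∀ z, ∃ x y, (x, y) ∈ A.graph ∧ z = x + y ∧ R z = x := fun z => by
    obtain ⟨p, rfl⟩ := hsurj z
    exact ⟨p.1.1, p.1.2, p.2, rfl, hR p⟩
  have hsym : R.IsSymmetric := by
    intro z w
    obtain ⟨x, y, hxy, rfl, hx⟩ := hgr z
    obtain ⟨a, b, hab, rfl, ha⟩ := hgr w
    simp only [ContinuousLinearMap.coe_coe]
    rw [hx, ha, inner_add_left, inner_add_right, hA.inner_eq hab hxy]
  refine ⟨R, ⟨hsym, ?_⟩, ⟨?_, ?_⟩, ?_⟩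
  · intro z
    obtain ⟨x, y, hxy, rfl, hx⟩ := hgr z
    have := h0 x y hxy
    rw [ContinuousLinearMap.reApplyInnerSelf_apply, hx, inner_add_right, map_add]
    exact add_nonneg inner_self_nonneg this
  · intro z w
    have := hsym z w
    simp only [ContinuousLinearMap.coe_coe] at this
    simp [inner_sub_left, inner_sub_right, this]
  · intro z
    obtain ⟨x, y, hxy, rfl, hx⟩ := hgr z
    have := h0 x y hxy
    rw [ContinuousLinearMap.reApplyInnerSelf_apply]
    rw [sub_apply, hx, one_apply_eq_self, add_sub_cancel_left,
      inner_add_right, map_add]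
    refine add_nonneg ?_ inner_self_nonneg
    rw [inner_re_symm]
    exact this
  · intro x y
    constructor
    · exact fun h => hR ⟨(x, y), h⟩
    · intro h
      obtain ⟨a, b, hab, h1, h2⟩ := hgr (x + y)
      rw [h] at h2
      subst h2
      rw [add_right_inj] at h1
      rwa [h1]

theorem denseRange_of_isSelfAdjoint {T : E →L[ℂ] E} (hT : IsSelfAdjoint T)
    (hi : Function.Injective T) : DenseRange T := by
  have h : (LinearMap.range (T : E →ₗ[ℂ] E))ᗮ = ⊥ := by
    rw [ContinuousLinearMap.orthogonal_range, ← ContinuousLinearMap.star_eq_adjoint, hT.star_eq]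
    exact LinearMap.ker_eq_bot.2 hi
  rw [← Submodule.topologicalClosure_eq_top_iff] at h
  have := Submodule.dense_iff_topologicalClosure_eq_top.2 h
  exact this

namespace IsPosResolvent

variable {A : E →ₗ.[ℂ] E} {R : E →L[ℂ] E}

theorem isSelfAdjoint (h : IsPosResolvent A R) : IsSelfAdjoint R := h.isPositive.isSelfAdjoint

theorem denseRange (h : IsPosResolvent A R) : DenseRange R :=
  denseRange_of_isSelfAdjoint h.isSelfAdjoint h.injective

end IsPosResolvent

end Complete

end ZenoDynamics

/-! ### Existence and uniqueness of the positive square root. -/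

namespace ZenoDynamics

variable {E : Type*} [NormedAddCommGroup E] [InnerProductSpace ℂ E] [CompleteSpace E]

namespace IsPosResolvent

variable {A : E →ₗ.[ℂ] E} {R : E →L[ℂ] E}

theorem sqrt_mul_sqrt (h : IsPosResolvent A R) : CFC.sqrt R * CFC.sqrt R = R :=
  CFC.sqrt_mul_sqrt_self R h.nonneg

theorem sqrt_one_sub_mul_sqrt_one_sub (h : IsPosResolvent A R) :
    CFC.sqrt (1 - R) * CFC.sqrt (1 - R) = 1 - R :=
  CFC.sqrt_mul_sqrt_self _ h.nonneg_one_sub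

theorem _root_.Commute.cfc_sqrt {S T : E →L[ℂ] E} (h : Commute S T) : Commute (CFC.sqrt S) T :=
  h.cfcₙ_nnreal _

theorem commute_sqrt : Commute (CFC.sqrt R) (CFC.sqrt (1 - R)) :=
  (((Commute.one_right R).sub_right (Commute.refl R)).cfc_sqrt.symm.cfc_sqrt).symm

theorem isSelfAdjoint_sqrt (T : E →L[ℂ] E) : IsSelfAdjoint (CFC.sqrt T) :=
  IsSelfAdjoint.of_nonneg (CFC.sqrt_nonneg T)

theorem injective_sqrt (h : IsPosResolvent A R) : Function.Injective (CFC.sqrt R : E →L[ℂ] E) := by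
  intro x y hxy
  apply h.injective
  rw [← h.sqrt_mul_sqrt, mul_apply_eq_comp, hxy, mul_apply_eq_comp]

theorem denseRange_sqrt (h : IsPosResolvent A R) : DenseRange (CFC.sqrt R : E →L[ℂ] E) :=
  denseRange_of_isSelfAdjoint (isSelfAdjoint_sqrt R) h.injective_sqrt

/-- The square root of `A` written as `(1 - R)^{1/2} R^{-1/2}`, where `R = (A + 1)⁻¹`. -/
noncomputable def sqrtOfResolvent (R : E →L[ℂ] E) : E →ₗ.[ℂ] E :=
  (LinearMap.range ((CFC.sqrt R).prod (CFC.sqrt (1 - R)) : E →ₗ[ℂ] E × E)).toLinearPMap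

theorem mem_graph_sqrtOfResolvent (h : IsPosResolvent A R) {x y : E} :
    (x, y) ∈ (sqrtOfResolvent R).graph ↔ ∃ v, CFC.sqrt R v = x ∧ CFC.sqrt (1 - R) v = y := by
  rw [sqrtOfResolvent, Submodule.toLinearPMap_graph_eq]
  · simp [Prod.ext_iff]
  · rintro _ ⟨v, rfl⟩ hv
    have : CFC.sqrt R v = 0 := hv
    rw [map_eq_zero_iff _ h.injective_sqrt] at this
    simp [this]

theorem inner_sqrt (T : E →L[ℂ] E) (x y : E) :
    inner ℂ (CFC.sqrt T x) y = inner ℂ x (CFC.sqrt T y) :=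
  (isSelfAdjoint_sqrt T).isSymmetric x y

theorem dense_domain_sqrtOfResolvent (h : IsPosResolvent A R) :
    Dense ((sqrtOfResolvent R).domain : Set E) := by
  refine h.denseRange_sqrt.mono ?_
  rintro _ ⟨v, rfl⟩
  exact LinearPMap.mem_domain_iff.2 ⟨_, h.mem_graph_sqrtOfResolvent.2 ⟨v, rfl, rfl⟩⟩

theorem commute_sqrt_apply (R : E →L[ℂ] E) (x : E) :
    CFC.sqrt R (CFC.sqrt (1 - R) x) = CFC.sqrt (1 - R) (CFC.sqrt R x) :=
  congrArg (fun T : E →L[ℂ] E => T x) (commute_sqrt (R := R)).eq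

theorem sqrt_sqrt_apply (h : IsPosResolvent A R) (x : E) : CFC.sqrt R (CFC.sqrt R x) = R x :=
  congrArg (fun T : E →L[ℂ] E => T x) h.sqrt_mul_sqrt

theorem sqrt_one_sub_apply (h : IsPosResolvent A R) (x : E) :
    CFC.sqrt (1 - R) (CFC.sqrt (1 - R) x) = x - R x :=
  congrArg (fun T : E →L[ℂ] E => T x) h.sqrt_one_sub_mul_sqrt_one_sub

theorem isSelfAdjoint_sqrtOfResolvent (h : IsPosResolvent A R) :
    IsSelfAdjoint (sqrtOfResolvent R) := by
  rw [isSelfAdjoint_iff_mem_graph h.dense_domain_sqrtOfResolvent]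
  intro x y
  constructor
  · intro hxy a b hab
    obtain ⟨v, rfl, rfl⟩ := h.mem_graph_sqrtOfResolvent.1 hxy
    obtain ⟨w, rfl, rfl⟩ := h.mem_graph_sqrtOfResolvent.1 hab
    rw [inner_sqrt, inner_sqrt, commute_sqrt_apply]
  · intro H
    have key : CFC.sqrt (1 - R) x = CFC.sqrt R y := by
      refine ext_inner_left ℂ fun w => ?_
      rw [← inner_sqrt, ← inner_sqrt]
      exact H _ _ (h.mem_graph_sqrtOfResolvent.2 ⟨w, rfl, rfl⟩)
    -- If `x = R^{1/2} v` and `y = (1 - R)^{1/2} v`, then `v = R v + (1 - R) v` is this sum.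
    refine h.mem_graph_sqrtOfResolvent.2 ⟨CFC.sqrt R x + CFC.sqrt (1 - R) y, ?_, ?_⟩
    · rw [map_add, commute_sqrt_apply, ← key, h.sqrt_sqrt_apply, h.sqrt_one_sub_apply]
      abel
    · rw [map_add, ← commute_sqrt_apply, key, h.sqrt_sqrt_apply, h.sqrt_one_sub_apply]
      abel

theorem isPositiveSqrt_sqrtOfResolvent (h : IsPosResolvent A R) :
    IsPositiveSqrt A (sqrtOfResolvent R) := by
  refine ⟨h.isSelfAdjoint_sqrtOfResolvent, ?_, ?_⟩
  · intro x
    obtain ⟨v, hv, hv'⟩ := h.mem_graph_sqrtOfResolvent.1 ((sqrtOfResolvent R).mem_graph x)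
    rw [← hv, ← hv', inner_sqrt]
    have : 0 ≤ CFC.sqrt R * CFC.sqrt (1 - R) :=
      commute_sqrt.mul_nonneg (CFC.sqrt_nonneg _) (CFC.sqrt_nonneg _)
    exact ((ContinuousLinearMap.nonneg_iff_isPositive _).1 this).re_inner_nonneg_right v
  · apply LinearPMap.eq_of_eq_graph
    ext ⟨x, y⟩
    rw [mem_graph_opComp, h.mem_graph_iff]
    constructor
    · rintro ⟨w, h1, h2⟩
      obtain ⟨v, rfl, rfl⟩ := h.mem_graph_sqrtOfResolvent.1 h1
      obtain ⟨u, hu, rfl⟩ := h.mem_graph_sqrtOfResolvent.1 h2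
      rw [← h.sqrt_sqrt_apply, map_add, commute_sqrt_apply, hu, h.sqrt_sqrt_apply,
        h.sqrt_one_sub_apply]
      congr 1
      abel
    · intro hx
      -- `u = (A + 1) x`, so `x = R u` and the intermediate vector `A^{1/2} x` is `(1 - R)^{1/2}
      -- R^{1/2} u`.
      set u := x + y
      have hy : y = u - R u := by rw [hx]; simp [u]
      refine ⟨CFC.sqrt (1 - R) (CFC.sqrt R u), h.mem_graph_sqrtOfResolvent.2
        ⟨CFC.sqrt R u, by rw [h.sqrt_sqrt_apply, hx], rfl⟩, h.mem_graph_sqrtOfResolvent.2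
        ⟨CFC.sqrt (1 - R) u, commute_sqrt_apply _ _, by rw [h.sqrt_one_sub_apply, hy]⟩⟩

end IsPosResolvent

/-- Self-adjoint operators are maximal symmetric, so one inclusion of graphs suffices. -/
theorem _root_.IsSelfAdjoint.eq_of_le {S T : E →ₗ.[ℂ] E} (hS : IsSelfAdjoint S)
    (hT : IsSelfAdjoint T) (h : S.graph ≤ T.graph) : S = T := by
  refine LinearPMap.eq_of_eq_graph (le_antisymm h ?_)
  rintro ⟨x, y⟩ hxy
  rw [hS.mem_graph_iff]
  exact fun a b hab => hT.inner_eq hxy (h hab)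

theorem IsPositiveSqrt.mem_graph_iff {A S : E →ₗ.[ℂ] E} (hS : IsPositiveSqrt A S) {x z : E} :
    (x, z) ∈ A.graph ↔ ∃ y, (x, y) ∈ S.graph ∧ (y, z) ∈ S.graph := by
  rw [← mem_graph_opComp, hS.sq]

theorem IsPositiveSqrt.re_inner_nonneg {A S : E →ₗ.[ℂ] E} (hS : IsPositiveSqrt A S) {x y : E}
    (h : (x, y) ∈ S.graph) : 0 ≤ (inner ℂ x y).re := by
  obtain ⟨z, rfl, rfl⟩ := S.mem_graph_iff.1 h
  exact hS.nonneg z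

namespace IsPosResolvent

variable {A S : E →ₗ.[ℂ] E} {R : E →L[ℂ] E}

/-- The positive square root commutes with the resolvent. -/
theorem resolvent_mem_graph (h : IsPosResolvent A R) (hS : IsPositiveSqrt A S) {x y : E}
    (hxy : (x, y) ∈ S.graph) : (R x, R y) ∈ S.graph := by
  obtain ⟨w, h1, h2⟩ := hS.mem_graph_iff.1 (h.apply_mem_graph x)
  -- With `w = S R x`, `S w = x - R x`, so `A w = S (x - R x) = y - w`; thus `(A + 1) w = y` and `w
  -- = R y`.
  have h3 : (w, y - w) ∈ A.graph := by
    refine hS.mem_graph_iff.2 ⟨_, h2, ?_⟩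
    have := S.graph.sub_mem hxy h1
    simpa using this
  rw [h.mem_graph_iff] at h3
  simp only [add_sub_cancel] at h3
  rwa [h3]

/-- `M = S R` is bounded and positive with `M² = R (1 - R)`, because `S` commutes with `R`.
Uniqueness of bounded positive square roots identifies it with `R^{1/2} (1 - R)^{1/2}`. -/
theorem apply_sqrt_mem_graph (h : IsPosResolvent A R) (hS : IsPositiveSqrt A S) (x : E) :
    (R x, CFC.sqrt (1 - R) (CFC.sqrt R x)) ∈ S.graph := by
  have hex : ∀ x, ∃ w, (R x, w) ∈ S.graph ∧ (w, x - R x) ∈ S.graph := fun x =>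
    hS.mem_graph_iff.1 (h.apply_mem_graph x)
  choose m h1 h2 using hex
  have hfun : ∀ {x y z}, (x, y) ∈ S.graph → (x, z) ∈ S.graph → y = z := fun hy hz =>
    S.mem_graph_snd_inj hy hz rfl
  let M₀ : E →ₗ[ℂ] E :=
    { toFun := m
      map_add' := fun x y => hfun (h1 _) (by simpa using S.graph.add_mem (h1 x) (h1 y))
      map_smul' := fun a x => hfun (h1 _) (by simpa using S.graph.smul_mem a (h1 x)) }
  have hMb : ∀ x, ‖m x‖ ^ 2 ≤ ‖x‖ ^ 2 := by
    intro x
    have e1 : inner ℂ (m x) (m x) = inner ℂ (R x) (x - R x) :=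
      hS.selfAdjoint.inner_eq (h2 x) (h1 x)
    have e2 : ‖m x‖ ^ 2 = RCLike.re (inner ℂ (R x) (x - R x)) := by
      rw [← e1, inner_self_eq_norm_sq]
    have e3 : ‖x‖ ^ 2 = ‖R x‖ ^ 2 + 2 * RCLike.re (inner ℂ (R x) (x - R x)) + ‖x - R x‖ ^ 2 := by
      rw [← norm_add_sq (𝕜 := ℂ), add_sub_cancel]
    nlinarith [sq_nonneg ‖R x‖, sq_nonneg ‖x - R x‖, sq_nonneg ‖m x‖]
  let M : E →L[ℂ] E := M₀.mkContinuous 1 fun x => by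
    rw [one_mul]
    exact (sq_le_sq₀ (norm_nonneg _) (norm_nonneg _)).1 (hMb x)
  have hM : ∀ x, M x = m x := fun x => rfl
  have hMsym : M.IsSymmetric := by
    intro x y
    simp only [ContinuousLinearMap.coe_coe, hM]
    have e1 : inner ℂ (m x) (R y) = inner ℂ (R x) (m y) := hS.selfAdjoint.inner_eq (h1 y) (h1 x)
    have e2 : inner ℂ (x - R x) (m y) = inner ℂ (m x) (y - R y) :=
      hS.selfAdjoint.inner_eq (h2 y) (h2 x)
    rw [inner_sub_left, inner_sub_right] at e2
    linear_combination e1 - e2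
  have hMpos : 0 ≤ M := by
    refine (ContinuousLinearMap.nonneg_iff_isPositive _).2 ⟨hMsym, fun x => ?_⟩
    rw [ContinuousLinearMap.reApplyInnerSelf_apply, hM]
    have e1 := hS.re_inner_nonneg (h1 x)
    have e2 := hS.re_inner_nonneg (h2 x)
    -- Splitting `x = R x + (x - R x)` leaves two values of the form of `S`, at `R x` and at `m x`.
    have : inner ℂ (m x) x = inner ℂ (m x) (R x) + inner ℂ (m x) (x - R x) := by
      rw [← inner_add_right, add_sub_cancel]
    rw [this, map_add, inner_re_symm]
    exact add_nonneg e1 e2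
  have hMsq : M * M = R * (1 - R) := by
    ext x
    simp only [mul_apply_eq_comp, hM]
    have e1 : (R (m x), R (x - R x)) ∈ S.graph := h.resolvent_mem_graph hS (h2 x)
    rw [hfun (h1 (m x)) e1]
    rfl
  have hBC : CFC.sqrt R * CFC.sqrt (1 - R) * (CFC.sqrt R * CFC.sqrt (1 - R)) = R * (1 - R) := by
    rw [(commute_sqrt (R := R)).symm.mul_mul_mul_comm, h.sqrt_mul_sqrt, h.sqrt_one_sub_mul_sqrt_one_sub]
  have hMeq : M = CFC.sqrt R * CFC.sqrt (1 - R) := by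
    rw [← CFC.sqrt_unique hMsq hMpos]
    exact CFC.sqrt_unique hBC
      (commute_sqrt.mul_nonneg (CFC.sqrt_nonneg _) (CFC.sqrt_nonneg _))
  have := h1 x
  rw [← hM, hMeq, commute_sqrt.eq] at this
  exact this

/-- The positive square root is unique. -/
theorem eq_sqrtOfResolvent (h : IsPosResolvent A R) (hS : IsPositiveSqrt A S) :
    S = sqrtOfResolvent R := by
  refine (h.isSelfAdjoint_sqrtOfResolvent.eq_of_le hS.selfAdjoint ?_).symm
  rintro ⟨x, y⟩ hxy
  obtain ⟨v, rfl, rfl⟩ := h.mem_graph_sqrtOfResolvent.1 hxy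
  -- The inclusion is known for `v` in the dense range of `R^{1/2}`; closedness of `S` extends it to
  -- all `v`.
  have hcl : IsClosed {v : E | (CFC.sqrt R v, CFC.sqrt (1 - R) v) ∈ (S.graph : Set (E × E))} :=
    IsClosed.preimage (f := fun v => (CFC.sqrt R v, CFC.sqrt (1 - R) v)) (by fun_prop)
      hS.selfAdjoint.isClosed
  refine h.denseRange_sqrt.induction_on (p := fun v =>
    (CFC.sqrt R v, CFC.sqrt (1 - R) v) ∈ (S.graph : Set (E × E))) v hcl fun x => ?_
  rw [h.sqrt_sqrt_apply]
  exact h.apply_sqrt_mem_graph hS x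

theorem sqrtOp_eq (h : IsPosResolvent A R) : sqrtOp A = sqrtOfResolvent R := by
  have hex : ∃ S, IsPositiveSqrt A S := ⟨_, h.isPositiveSqrt_sqrtOfResolvent⟩
  rw [sqrtOp, dif_pos hex]
  exact h.eq_sqrtOfResolvent hex.choose_spec

end IsPosResolvent

end ZenoDynamics

/-! ### Unitary groups of semibounded and of bounded self-adjoint operators. -/

namespace ZenoDynamics

variable {E : Type*} [NormedAddCommGroup E] [InnerProductSpace ℂ E]

theorem tendsto_zero_of_denseRange {ι : Type*} {l : Filter ι} {T : ι → E →L[ℂ] E} {C : ℝ}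
    (hC : ∀ i, ‖T i‖ ≤ C) {R : E → E} (hR : DenseRange R)
    (h : ∀ y, Tendsto (fun i => T i (R y)) l (𝓝 0)) (x : E) :
    Tendsto (fun i => T i x) l (𝓝 0) := by
  rw [Metric.tendsto_nhds]
  intro ε hε
  have hD : 0 < |C| + 1 := by positivity
  obtain ⟨y, hy⟩ := hR.exists_dist_lt x (show 0 < ε / 2 / (|C| + 1) by positivity)
  filter_upwards [Metric.tendsto_nhds.1 (h y) (ε / 2) (half_pos hε)] with i hi
  rw [dist_zero_right] at hi ⊢
  rw [dist_eq_norm, lt_div_iff₀ hD] at hy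
  have h1 : ‖T i (x - R y)‖ ≤ (|C| + 1) * ‖x - R y‖ :=
    (T i).le_of_opNorm_le ((hC i).trans ((le_abs_self C).trans (by simp))) _
  have h2 : T i x = T i (x - R y) + T i (R y) := by simp
  rw [h2]
  refine (norm_add_le _ _).trans_lt ?_
  linarith

/-- The bounded function `r ↦ r exp(-i t (r⁻¹ - 1))`. -/
noncomputable def phase (t r : ℝ) : ℂ := r * Complex.exp (Complex.I * ↑(-t * (r⁻¹ - 1)))

theorem norm_exp_I_mul (x : ℝ) : ‖Complex.exp (Complex.I * x)‖ = 1 := by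
  rw [mul_comm, Complex.norm_exp_ofReal_mul_I]

theorem norm_phase (t r : ℝ) : ‖phase t r‖ = |r| := by
  rw [phase, norm_mul, norm_exp_I_mul, mul_one, Complex.norm_real, Real.norm_eq_abs]

/-- The factor `r` damps the oscillation at 0, which makes the continuous functional calculus
applicable to `R e^{-itA}`, though not to `e^{-itA}` itself. -/
theorem continuous_phase (t : ℝ) : Continuous (phase t) := by
  rw [continuous_iff_continuousAt]
  intro r
  rcases eq_or_ne r 0 with rfl | hr
  · have h0 : phase t 0 = 0 := by simp [phase]
    rw [ContinuousAt, h0, tendsto_zero_iff_norm_tendsto_zero]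
    simp_rw [norm_phase]
    exact (continuous_abs.tendsto' 0 0 abs_zero)
  · unfold phase
    fun_prop (disch := assumption)

theorem phase_zero (r : ℝ) : phase 0 r = r := by simp [phase]

theorem phase_mul_phase (s t r : ℝ) : phase s r * phase t r = r * phase (s + t) r := by
  unfold phase
  have : Complex.exp (Complex.I * ↑(-(s + t) * (r⁻¹ - 1))) =
      Complex.exp (Complex.I * ↑(-s * (r⁻¹ - 1))) *
        Complex.exp (Complex.I * ↑(-t * (r⁻¹ - 1))) := by
    rw [← Complex.exp_add]
    congr 1
    push_cast
    ring
  rw [this]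
  ring

theorem star_phase (t r : ℝ) : star (phase t r) = phase (-t) r := by
  simp only [phase, Complex.star_def, map_mul, Complex.conj_ofReal, ← Complex.exp_conj,
    Complex.conj_I]
  congr 2
  push_cast
  ring

theorem norm_phase_sub_le {r : ℝ} (h0 : 0 ≤ r) (h1 : r ≤ 1) (s t : ℝ) :
    ‖phase s r - phase t r‖ ≤ |s - t| := by
  rcases h0.eq_or_lt with rfl | hr
  · simp [phase]
  have e : phase s r - phase t r = r * Complex.exp (Complex.I * ↑(-t * (r⁻¹ - 1))) *
      (Complex.exp (Complex.I * ↑(-(s - t) * (r⁻¹ - 1))) - 1) := by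
    have : Complex.exp (Complex.I * ↑(-t * (r⁻¹ - 1))) *
        Complex.exp (Complex.I * ↑(-(s - t) * (r⁻¹ - 1))) =
        Complex.exp (Complex.I * ↑(-s * (r⁻¹ - 1))) := by
      rw [← Complex.exp_add]
      congr 1
      push_cast
      ring
    unfold phase
    linear_combination (-r : ℂ) * this
  rw [e, norm_mul, norm_mul, norm_exp_I_mul, Complex.norm_real, mul_one]
  refine (mul_le_mul_of_nonneg_left Real.norm_exp_I_mul_ofReal_sub_one_le (norm_nonneg _)).trans ?_
  rw [← norm_mul]
  have : r * (-(s - t) * (r⁻¹ - 1)) = -((s - t) * (1 - r)) := by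
    field_simp
  rw [this, norm_neg, norm_mul, Real.norm_eq_abs, Real.norm_eq_abs]
  refine mul_le_of_le_one_right (abs_nonneg _) ?_
  rw [abs_of_nonneg (by linarith)]
  linarith

theorem norm_exp_I_mul_sub_one_sub_le (x : ℝ) :
    ‖Complex.exp (Complex.I * x) - 1 - Complex.I * x‖ ≤ 2 * |x| ^ 2 := by
  have hx : ‖Complex.I * (x : ℂ)‖ = |x| := by simp
  rcases le_or_gt |x| 1 with h | h
  · refine (Complex.norm_exp_sub_one_sub_id_le (hx.trans_le h)).trans ?_
    rw [hx]
    nlinarith [sq_nonneg |x|]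
  · have h1 : ‖Complex.exp (Complex.I * x) - 1‖ ≤ |x| := Real.norm_exp_I_mul_ofReal_sub_one_le
    refine (norm_sub_le _ _).trans ?_
    rw [hx]
    nlinarith

/-- The second factor `r` absorbs the quadratic Taylor remainder: `r² (r⁻¹ - 1)² = (1 - r)² ≤ 1`,
uniformly in `r`. -/
theorem norm_mul_phase_sub_le {r : ℝ} (h0 : 0 ≤ r) (h1 : r ≤ 1) (t : ℝ) :
    ‖r * phase t r - r * r + t * Complex.I * (r * (1 - r))‖ ≤ 2 * |t| ^ 2 := by
  rcases h0.eq_or_lt with rfl | hr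
  · simp only [Complex.ofReal_zero, zero_mul, mul_zero, sub_zero, add_zero, norm_zero]
    positivity
  have hr' : (r : ℂ) ≠ 0 := by exact_mod_cast hr.ne'
  have e : r * phase t r - r * r + t * Complex.I * (r * (1 - r)) =
      ((r * r : ℝ) : ℂ) * (Complex.exp (Complex.I * ↑(-t * (r⁻¹ - 1))) - 1 -
        Complex.I * ↑(-t * (r⁻¹ - 1))) := by
    unfold phase
    push_cast
    field_simp
    ring
  rw [e, norm_mul, Complex.norm_real, Real.norm_eq_abs, abs_of_nonneg (by positivity)]
  refine (mul_le_mul_of_nonneg_left (norm_exp_I_mul_sub_one_sub_le _) (by positivity)).trans ?_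
  have e2 : r * r * (2 * |(-t * (r⁻¹ - 1))| ^ 2) = 2 * |t| ^ 2 * (1 - r) ^ 2 := by
    rw [sq_abs, sq_abs]
    field_simp
  rw [e2]
  refine mul_le_of_le_one_right (by positivity) ?_
  nlinarith

theorem shift_neg_shift (A : E →ₗ.[ℂ] E) (c : ℝ) : shift (-c) (shift c A) = A := by
  apply LinearPMap.eq_of_eq_graph
  ext ⟨x, y⟩
  have : y - ((-c : ℝ) : ℂ) • x - (c : ℂ) • x = y := by
    push_cast
    module
  rw [mem_graph_shift, mem_graph_shift, this]

section Complete

variable [CompleteSpace E]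

/-- The functional calculus of a self-adjoint operator for functions on the real line. -/
noncomputable def realCalc (R : E →L[ℂ] E) (g : ℝ → ℂ) : E →L[ℂ] E := cfc (fun z : ℂ => g z.re) R

namespace IsPosResolvent

variable {A : E →ₗ.[ℂ] E} {R : E →L[ℂ] E}

theorem realCalc_mul (R : E →L[ℂ] E) {f g : ℝ → ℂ} (hf : Continuous f) (hg : Continuous g) :
    realCalc R (fun r => f r * g r) = realCalc R f * realCalc R g :=
  cfc_mul (fun z : ℂ => f z.re) (fun z : ℂ => g z.re) R (by fun_prop) (by fun_prop)

theorem realCalc_add (R : E →L[ℂ] E) {f g : ℝ → ℂ} (hf : Continuous f) (hg : Continuous g) :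
    realCalc R (fun r => f r + g r) = realCalc R f + realCalc R g :=
  cfc_add R (fun z : ℂ => f z.re) (fun z : ℂ => g z.re) (by fun_prop) (by fun_prop)

theorem realCalc_sub (R : E →L[ℂ] E) {f g : ℝ → ℂ} (hf : Continuous f) (hg : Continuous g) :
    realCalc R (fun r => f r - g r) = realCalc R f - realCalc R g :=
  cfc_sub (fun z : ℂ => f z.re) (fun z : ℂ => g z.re) R (by fun_prop) (by fun_prop)

theorem realCalc_const_mul (R : E →L[ℂ] E) (c : ℂ) {f : ℝ → ℂ} (hf : Continuous f) :
    realCalc R (fun r => c * f r) = c • realCalc R f :=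
  cfc_const_mul c (fun z : ℂ => f z.re) R (by fun_prop)

theorem realCalc_star (R : E →L[ℂ] E) (f : ℝ → ℂ) :
    realCalc R (fun r => star (f r)) = star (realCalc R f) :=
  cfc_star (fun z : ℂ => f z.re) R

/-- The spectrum is real, so taking real parts loses nothing. -/
theorem realCalc_id (h : IsPosResolvent A R) : realCalc R (fun r => (r : ℂ)) = R := by
  have hn : IsStarNormal R := h.isSelfAdjoint.isStarNormal
  conv_rhs => rw [← cfc_id ℂ R]
  refine cfc_congr fun z hz => ?_
  exact Complex.ext rfl (by simpa using (h.isSelfAdjoint.im_eq_zero_of_mem_spectrum hz).symm)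

theorem realCalc_one (h : IsPosResolvent A R) : realCalc R (fun _ => 1) = 1 :=
  cfc_const_one ℂ R (ha := h.isSelfAdjoint.isStarNormal)

theorem norm_le_one (h : IsPosResolvent A R) : ‖R‖ ≤ 1 :=
  (CStarAlgebra.norm_le_one_iff_of_nonneg R h.nonneg).2 (sub_nonneg.1 h.nonneg_one_sub)

theorem norm_realCalc_le (h : IsPosResolvent A R) {f : ℝ → ℂ} {c : ℝ} (hc : 0 ≤ c)
    (hf : ∀ r, 0 ≤ r → r ≤ 1 → ‖f r‖ ≤ c) : ‖realCalc R f‖ ≤ c := by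
  refine norm_cfc_le hc fun z hz => hf _ ?_ ?_
  · open scoped ComplexOrder in
    exact (Complex.le_def.1 (spectrum_nonneg_of_nonneg h.nonneg hz)).1
  · refine (Complex.re_le_norm z).trans ((spectrum.norm_le_norm_mul_of_mem hz).trans ?_)
    exact mul_le_one₀ h.norm_le_one (norm_nonneg _) ContinuousLinearMap.norm_id_le

/-- The operator `R e^{-itA}`. -/
noncomputable def regGroup (R : E →L[ℂ] E) (t : ℝ) : E →L[ℂ] E := realCalc R (phase t)

theorem regGroup_zero (h : IsPosResolvent A R) : regGroup R 0 = R := by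
  conv_rhs => rw [← h.realCalc_id]
  rw [regGroup]
  congr 1
  funext r
  exact phase_zero r

theorem regGroup_mul_regGroup (h : IsPosResolvent A R) (s t : ℝ) :
    regGroup R s * regGroup R t = R * regGroup R (s + t) := by
  calc regGroup R s * regGroup R t = realCalc R (fun r => phase s r * phase t r) :=
        (realCalc_mul R (continuous_phase s) (continuous_phase t)).symm
    _ = realCalc R (fun r => r * phase (s + t) r) := by simp_rw [phase_mul_phase]
    _ = realCalc R (fun r => (r : ℂ)) * regGroup R (s + t) :=
        realCalc_mul R Complex.continuous_ofReal (continuous_phase _)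
    _ = R * regGroup R (s + t) := by rw [h.realCalc_id]

theorem star_regGroup (R : E →L[ℂ] E) (t : ℝ) : star (regGroup R t) = regGroup R (-t) := by
  rw [regGroup, ← realCalc_star, regGroup]
  congr 1
  funext r
  exact star_phase t r

theorem commute_regGroup (h : IsPosResolvent A R) (t : ℝ) : Commute (regGroup R t) R := by
  have h1 := h.regGroup_mul_regGroup t 0
  have h2 := h.regGroup_mul_regGroup 0 t
  rw [h.regGroup_zero] at h1 h2
  rw [Commute, SemiconjBy, h1, h2, add_zero, zero_add]

/-- This makes `R x ↦ R e^{-itA} x` well defined and isometric, hence extendable from the dense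
range of `R`. -/
theorem norm_regGroup_apply (h : IsPosResolvent A R) (t : ℝ) (x : E) :
    ‖regGroup R t x‖ = ‖R x‖ := by
  have e : star (regGroup R t) * regGroup R t = star R * R := by
    rw [star_regGroup, h.regGroup_mul_regGroup, neg_add_cancel, h.regGroup_zero,
      h.isSelfAdjoint.star_eq]
  have h1 : ∀ T : E →L[ℂ] E, ‖T x‖ ^ 2 = RCLike.re (inner ℂ x ((star T * T) x)) := fun T => by
    rw [mul_apply_eq_comp, ContinuousLinearMap.star_eq_adjoint,
      ContinuousLinearMap.adjoint_inner_right, inner_self_eq_norm_sq]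
  rw [← sq_eq_sq₀ (norm_nonneg _) (norm_nonneg _), h1, h1, e]

theorem norm_regGroup_sub_le (h : IsPosResolvent A R) (s t : ℝ) :
    ‖regGroup R s - regGroup R t‖ ≤ |s - t| := by
  rw [regGroup, regGroup, ← realCalc_sub R (continuous_phase s) (continuous_phase t)]
  exact h.norm_realCalc_le (abs_nonneg _) fun r h0 h1 => norm_phase_sub_le h0 h1 s t

theorem norm_mul_regGroup_sub_le (h : IsPosResolvent A R) (t : ℝ) :
    ‖R * regGroup R t - R * R + ((t : ℂ) * Complex.I) • (R * (1 - R))‖ ≤ 2 * |t| ^ 2 := by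
  have hc : Continuous fun r : ℝ => (r : ℂ) := Complex.continuous_ofReal
  have hp := continuous_phase t
  have e : realCalc R (fun r => r * phase t r - r * r + t * Complex.I * (r * (1 - r))) =
      R * regGroup R t - R * R + ((t : ℂ) * Complex.I) • (R * (1 - R)) := by
    rw [realCalc_add R (f := fun r : ℝ => r * phase t r - r * r) (by fun_prop) (by fun_prop),
      realCalc_sub R (f := fun r : ℝ => r * phase t r) (by fun_prop) (by fun_prop),
      realCalc_const_mul R _ (by fun_prop), realCalc_mul R hc hp, realCalc_mul R hc hc,
      realCalc_mul R hc (g := fun r : ℝ => 1 - r) (by fun_prop),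
      realCalc_sub R (f := fun _ => 1) (by fun_prop) hc, h.realCalc_id, h.realCalc_one, regGroup]
  rw [← e]
  exact h.norm_realCalc_le (by positivity) fun r h0 h1 => norm_mul_phase_sub_le h0 h1 t

/-- The unitary group `e^{-itA}`. -/
noncomputable def group (R : E →L[ℂ] E) (t : ℝ) : E →L[ℂ] E :=
  (regGroup R t : E →ₗ[ℂ] E).extendOfNorm (R : E →ₗ[ℂ] E)

theorem group_apply (h : IsPosResolvent A R) (t : ℝ) (x : E) : group R t (R x) = regGroup R t x :=
  LinearMap.extendOfNorm_eq (f := (regGroup R t : E →ₗ[ℂ] E)) (e := (R : E →ₗ[ℂ] E)) h.denseRange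
    ⟨1, fun y => by simp [h.norm_regGroup_apply t y]⟩ x

theorem norm_group_le (h : IsPosResolvent A R) (t : ℝ) : ‖group R t‖ ≤ 1 :=
  LinearMap.opNorm_extendOfNorm_le (f := (regGroup R t : E →ₗ[ℂ] E)) (e := (R : E →ₗ[ℂ] E))
    h.denseRange zero_le_one fun y => by simp [h.norm_regGroup_apply t y]

theorem group_mul (h : IsPosResolvent A R) (t : ℝ) : group R t * R = regGroup R t :=
  ContinuousLinearMap.ext fun x => h.group_apply t x

theorem mul_right_cancel (h : IsPosResolvent A R) {S T : E →L[ℂ] E} (e : S * R = T * R) :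
    S = T := by
  refine DFunLike.coe_injective (h.denseRange.equalizer S.continuous T.continuous ?_)
  funext x
  exact congrArg (fun L : E →L[ℂ] E => L x) e

theorem group_zero (h : IsPosResolvent A R) : group R 0 = 1 :=
  h.mul_right_cancel (by rw [h.group_mul, h.regGroup_zero, one_mul])

theorem group_add (h : IsPosResolvent A R) (s t : ℝ) :
    group R (s + t) = group R s * group R t := by
  -- The product of two regularized groups carries `R` twice, hence two cancellations.
  apply h.mul_right_cancel
  apply h.mul_right_cancel
  rw [mul_assoc (group R s), h.group_mul, h.group_mul, mul_assoc,
    (h.commute_regGroup t).eq, ← mul_assoc, h.group_mul, h.regGroup_mul_regGroup,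
    (h.commute_regGroup _).eq]

theorem commute_group (h : IsPosResolvent A R) (t : ℝ) : Commute (group R t) R := by
  apply h.mul_right_cancel
  rw [h.group_mul, mul_assoc, h.group_mul, (h.commute_regGroup t).eq]

theorem star_group (h : IsPosResolvent A R) (t : ℝ) : star (group R t) = group R (-t) := by
  apply h.mul_right_cancel
  have h1 := congrArg star ((h.commute_group t).eq.symm.trans (h.group_mul t))
  rw [star_mul, star_regGroup, h.isSelfAdjoint.star_eq] at h1
  rw [h1, h.group_mul]

theorem group_mem_unitary (h : IsPosResolvent A R) (t : ℝ) :
    group R t ∈ unitary (E →L[ℂ] E) := by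
  rw [Unitary.mem_iff, h.star_group, ← h.group_add, ← h.group_add]
  simp [h.group_zero]

theorem continuous_group (h : IsPosResolvent A R) (x : E) :
    Continuous fun t => group R t x := by
  refine continuous_of_uniform_approx_of_continuous fun u hu => ?_
  obtain ⟨ε, hε, hu⟩ := Metric.mem_uniformity_dist.1 hu
  obtain ⟨y, hy⟩ := h.denseRange.exists_dist_lt x hε
  refine ⟨fun t => group R t (R y), ?_, fun t => hu ?_⟩
  · simp_rw [h.group_apply]
    refine (LipschitzWith.of_dist_le_mul (K := ‖y‖₊) fun s t => ?_).continuous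
    rw [dist_eq_norm, ← sub_apply, Real.dist_eq, coe_nnnorm, mul_comm]
    exact (regGroup R s - regGroup R t).le_of_opNorm_le (h.norm_regGroup_sub_le s t) y
  · rw [dist_eq_norm, ← map_sub]
    refine ((group R t).le_of_opNorm_le (h.norm_group_le t) _).trans_lt ?_
    rwa [one_mul, ← dist_eq_norm]

theorem hasDerivAt_group (h : IsPosResolvent A R) (x : E) :
    HasDerivAt (fun t => group R t (R x)) (-Complex.I • (1 - R) x) 0 := by
  simp_rw [h.group_apply]
  rw [hasDerivAt_iff_tendsto_slope_zero]
  -- Difference quotient minus candidate derivative. It is bounded uniformly in `t`, and on `ran R`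
  -- it is `O(|t|)`; density of `ran R` gives strong convergence.
  let T : ℝ → E →L[ℂ] E := fun t =>
    (t : ℂ)⁻¹ • (regGroup R t - R) + Complex.I • (1 - R)
  have hT : ∀ t, ‖T t‖ ≤ 1 + ‖Complex.I • (1 - R)‖ := fun t => by
    refine (norm_add_le _ _).trans (add_le_add_left ?_ _)
    have := h.norm_regGroup_sub_le t 0
    rw [h.regGroup_zero, sub_zero] at this
    rw [norm_smul, norm_inv, Complex.norm_real, Real.norm_eq_abs]
    exact (mul_le_mul_of_nonneg_left this (by positivity)).trans (inv_mul_le_one)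
  have hTR : ∀ y, Tendsto (fun t => T t (R y)) (𝓝[≠] 0) (𝓝 0) := fun y => by
    have h0 : Tendsto (fun t : ℝ => 2 * |t| * ‖y‖) (𝓝[≠] 0) (𝓝 0) := by
      refine Tendsto.mono_left ?_ nhdsWithin_le_nhds
      exact Continuous.tendsto' (by fun_prop) _ _ (by simp)
    refine squeeze_zero_norm' ?_ h0
    filter_upwards [self_mem_nhdsWithin] with t ht
    have ht' : (t : ℂ) ≠ 0 := by exact_mod_cast ht
    have e : T t * R = (t : ℂ)⁻¹ •
        (R * regGroup R t - R * R + ((t : ℂ) * Complex.I) • (R * (1 - R))) := by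
      simp only [T, add_mul, smul_mul_assoc, sub_mul, mul_sub, (h.commute_regGroup t).eq,
        smul_add, smul_smul, one_mul, mul_one]
      rw [inv_mul_cancel_left₀ ht']
    have e' : T t (R y) = (T t * R) y := rfl
    rw [e', e]
    refine ContinuousLinearMap.le_of_opNorm_le _ ?_ y
    rw [norm_smul, norm_inv, Complex.norm_real, Real.norm_eq_abs]
    refine (mul_le_mul_of_nonneg_left (h.norm_mul_regGroup_sub_le t) (by positivity)).trans ?_
    have : |t| ≠ 0 := abs_ne_zero.2 ht
    apply le_of_eq
    field_simp
  have := (tendsto_zero_of_denseRange hT h.denseRange hTR x).add_const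
    (-Complex.I • (1 - R) x)
  rw [zero_add] at this
  refine this.congr fun t => ?_
  simp only [T, add_apply, smul_apply, sub_apply, zero_add, h.regGroup_zero]
  rw [neg_smul, add_neg_cancel_right, ← Complex.ofReal_inv, Complex.coe_smul]

theorem isUnitaryGroupOf_group (hA : IsSelfAdjoint A) (h : IsPosResolvent A R) :
    IsUnitaryGroupOf A (group R) where
  mem_unitary := h.group_mem_unitary
  map_zero := h.group_zero
  map_add := h.group_add
  continuous := h.continuous_group
  mem_graph_iff := by
    have key : ∀ {x y}, (x, y) ∈ A.graph → HasDerivAt (fun t => group R t x) (-Complex.I • y) 0 := by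
      intro x y hxy
      rw [h.mem_graph_iff] at hxy
      have := h.hasDerivAt_group (x + y)
      rw [sub_apply, hxy, one_apply_eq_self, add_sub_cancel_left] at this
      exact this
    intro x y
    refine ⟨key, fun hd => ?_⟩
    -- The generator is no larger than `A`: moving the group across the inner product and
    -- differentiating puts `(x, y)` in the graph of the adjoint of `A`, which is `A`.
    rw [hA.mem_graph_iff]
    intro a b hab
    have h1 : HasDerivAt (fun t => inner ℂ a (group R t x)) (inner ℂ a (-Complex.I • y)) 0 := by
      simpa using (hasDerivAt_const (0 : ℝ) a).inner ℂ hd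
    have hab' : HasDerivAt (fun t => group R (-t) a) (Complex.I • b) 0 := by
      have hk := key hab
      rw [← neg_zero] at hk
      simpa [Function.comp_def] using hk.scomp (0 : ℝ) (hasDerivAt_neg 0)
    have h2 : HasDerivAt (fun t => inner ℂ (group R (-t) a) x) (inner ℂ (Complex.I • b) x) 0 := by
      exact (hab'.inner ℂ (hasDerivAt_const (0 : ℝ) x)).congr_deriv (by
        rw [inner_zero_right, zero_add])
    have e : (fun t => inner ℂ a (group R t x)) = fun t => inner ℂ (group R (-t) a) x := by
      funext t
      rw [← h.star_group, ContinuousLinearMap.star_eq_adjoint,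
        ContinuousLinearMap.adjoint_inner_left]
    rw [e] at h1
    have := h1.unique h2
    rw [inner_smul_left, inner_smul_right, Complex.conj_I] at this
    exact (mul_left_cancel₀ (neg_ne_zero.2 Complex.I_ne_zero) this).symm

end IsPosResolvent

theorem IsUnitaryGroupOf.shift {A : E →ₗ.[ℂ] E} {U : ℝ → E →L[ℂ] E} (h : IsUnitaryGroupOf A U)
    (c : ℝ) : IsUnitaryGroupOf (shift c A)
      (fun t => Complex.exp (Complex.I * ↑(-c * t)) • U t) where
  mem_unitary t := by
    have hz : star (Complex.exp (Complex.I * ↑(-c * t))) * Complex.exp (Complex.I * ↑(-c * t))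
        = 1 := by
      rw [Complex.star_def, Complex.conj_mul', norm_exp_I_mul]
      simp
    have := Unitary.mem_iff.1 (h.mem_unitary t)
    rw [Unitary.mem_iff, star_smul, smul_mul_smul_comm, smul_mul_smul_comm, this.1, this.2,
      mul_comm (Complex.exp _), hz]
    simp
  map_zero := by simp [h.map_zero]
  map_add s t := by
    rw [h.map_add, smul_mul_smul_comm, ← Complex.exp_add]
    congr 3
    push_cast
    ring
  continuous x := by
    have := h.continuous x
    simp only [smul_apply]
    fun_prop
  mem_graph_iff x y := by
    have hexp : ∀ a : ℝ, HasDerivAt (fun t : ℝ => Complex.exp (Complex.I * ↑(a * t)))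
        (Complex.I * a) 0 := fun a => by
      have h1 : HasDerivAt (fun t : ℝ => Complex.I * ((a * t : ℝ) : ℂ)) (Complex.I * a) 0 := by
        have : HasDerivAt (fun t : ℝ => a * t) (a * 1) 0 := (hasDerivAt_id (0 : ℝ)).const_mul a
        rw [mul_one] at this
        exact this.ofReal_comp.const_mul _
      simpa using h1.cexp
    rw [mem_graph_shift, h.mem_graph_iff]
    simp only [smul_apply]
    constructor
    · intro hd
      have := (hexp (-c)).smul hd
      refine this.congr_deriv ?_
      simp only [mul_zero, Complex.ofReal_zero, Complex.exp_zero, one_smul, h.map_zero,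
        one_apply_eq_self]
      push_cast
      module
    · intro hd
      have := ((hexp c).smul hd).congr_deriv (g' := -Complex.I • (y - (c : ℂ) • x)) (by
        simp only [mul_zero, Complex.ofReal_zero, Complex.exp_zero, one_smul, h.map_zero,
          one_apply_eq_self]
        module)
      refine this.congr_of_eventuallyEq (Eventually.of_forall fun t => ?_)
      simp only [Pi.smul_apply', smul_smul, ← Complex.exp_add]
      rw [← mul_add, ← Complex.ofReal_add]
      simp

/-- Stone's theorem for a self-adjoint operator bounded from below. -/
theorem exists_isUnitaryGroupOf {H : E →ₗ.[ℂ] E} (hH : IsSelfAdjoint H) {c : ℝ}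
    (hc : IsBoundedBelow H c) : ∃ U, IsUnitaryGroupOf H U := by
  have hs := isSelfAdjoint_shift hH c
  obtain ⟨R, hR⟩ := exists_isPosResolvent hs fun x y => shift_nonneg hc
  have := (hR.isUnitaryGroupOf_group hs).shift (-c)
  rw [shift_neg_shift] at this
  exact ⟨_, this⟩

/-- A bounded self-adjoint operator generates a unitary group. -/
theorem exists_isUnitaryGroupOf_toPMap {K : E →L[ℂ] E} (hK : IsSelfAdjoint K) :
    ∃ U, IsUnitaryGroupOf ((K : E →ₗ[ℂ] E).toPMap ⊤) U := by
  let X : E →L[ℂ] E := -Complex.I • K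
  have hd : ∀ t : ℝ, HasDerivAt (fun s : ℝ => NormedSpace.exp (s • X))
      (NormedSpace.exp (t • X) * X) t := fun t => hasDerivAt_exp_smul_const X t
  have hx : ∀ x : E, ∀ t : ℝ, HasDerivAt (fun s : ℝ => NormedSpace.exp (s • X) x)
      ((NormedSpace.exp (t • X) * X) x) t := fun x t => by
    exact ((ContinuousLinearMap.apply ℂ E x).restrictScalars ℝ).hasFDerivAt.comp_hasDerivAt t (hd t)
  refine ⟨fun t => NormedSpace.exp (t • X), ?_, by simp, ?_, ?_, ?_⟩
  · intro t
    have hs : IsSelfAdjoint (-t • K) := (IsSelfAdjoint.all (-t)).smul hK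
    have := (selfAdjoint.expUnitary ⟨-t • K, hs⟩).2
    rw [selfAdjoint.expUnitary_coe] at this
    have e : t • X = Complex.I • (-t • K) := by
      simp only [X]
      rw [neg_smul, neg_smul, smul_neg, smul_neg, smul_comm]
    rw [e]
    exact this
  · intro s t
    let _ : NormedAlgebra ℚ (E →L[ℂ] E) := NormedAlgebra.restrictScalars ℚ ℂ _
    rw [add_smul]
    exact NormedSpace.exp_add_of_commute
      (((Commute.refl X).smul_left s).smul_right t)
  · exact fun x => continuous_iff_continuousAt.2 fun t => (hx x t).continuousAt
  · intro x y
    rw [mem_graph_toPMap_top]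
    have h0 := hx x 0
    have e : (NormedSpace.exp ((0 : ℝ) • X) * X) x = -Complex.I • K x := by simp [X]
    rw [e] at h0
    constructor
    · rintro rfl
      exact h0
    · intro hy
      have := h0.unique hy
      exact smul_right_injective E (neg_ne_zero.2 Complex.I_ne_zero) this

end Complete

end ZenoDynamics

/-! ### Telescoping, first-order behaviour of the compressed group, and the product formula. -/

namespace ZenoDynamics

variable {E : Type*} [NormedAddCommGroup E] [InnerProductSpace ℂ E]

/-- Telescoping with the powers of `F` applied first: they stay in the range of `P`, so only `(F -
G) * P` has to be small. -/
theorem norm_pow_sub_pow_apply_le {F G P : E →L[ℂ] E} (hF : ‖F‖ ≤ 1) (hG : ‖G‖ ≤ 1)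
    (hPF : P * F = F) {x : E} (hx : P x = x) (n : ℕ) :
    ‖(F ^ n) x - (G ^ n) x‖ ≤ n * ‖(F - G) * P‖ * ‖x‖ := by
  have hmem : ∀ k, P ((F ^ k) x) = (F ^ k) x := by
    intro k
    cases k with
    | zero => simpa using hx
    | succ k =>
      rw [pow_succ']
      exact congrArg (fun T : E →L[ℂ] E => T ((F ^ k) x)) hPF
  have hnorm : ∀ k, ‖(F ^ k) x‖ ≤ ‖x‖ := by
    intro k
    induction k with
    | zero => simp
    | succ k ih =>
      rw [pow_succ', mul_apply_eq_comp]
      exact (F.le_of_opNorm_le hF _).trans (by rwa [one_mul])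
  induction n with
  | zero => simp
  | succ n ih =>
    have e : (F ^ (n + 1)) x - (G ^ (n + 1)) x =
        ((F - G) * P) ((F ^ n) x) + G ((F ^ n) x - (G ^ n) x) := by
      rw [mul_apply_eq_comp, hmem, pow_succ', pow_succ', mul_apply_eq_comp, mul_apply_eq_comp,
        sub_apply, map_sub]
      abel
    rw [e]
    have h1 := (((F - G) * P).le_opNorm ((F ^ n) x)).trans
      (mul_le_mul_of_nonneg_left (hnorm n) (norm_nonneg _))
    have h2 := (G.le_of_opNorm_le hG ((F ^ n) x - (G ^ n) x)).trans
      ((one_mul _).trans_le ih)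
    refine (norm_add_le _ _).trans ((add_le_add h1 h2).trans_eq ?_)
    push_cast
    ring

/-- In a basis of the range of `P`, `T i * P` is a finite sum of rank-one operators, so strong
convergence becomes norm convergence. -/
theorem tendsto_mul_of_finiteDimensional_range {ι : Type*} {l : Filter ι} {T : ι → E →L[ℂ] E}
    {P : E →L[ℂ] E} (hfin : FiniteDimensional ℂ (LinearMap.range (P : E →ₗ[ℂ] E)))
    (h : ∀ x, Tendsto (fun i => T i (P x)) l (𝓝 0)) :
    Tendsto (fun i => T i * P) l (𝓝 0) := by
  let b := Module.finBasis ℂ (LinearMap.range (P : E →ₗ[ℂ] E))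
  let φ : Fin _ → E →L[ℂ] ℂ := fun j =>
    (LinearMap.toContinuousLinearMap (b.coord j)).comp P.rangeRestrict
  have e : ∀ i, T i * P = ∑ j, (φ j).smulRight (T i (b j)) := by
    intro i
    ext x
    have hx : P x = ∑ j, φ j x • (b j : E) := by
      have := congrArg Subtype.val (b.sum_repr (P.rangeRestrict x))
      simp only [Submodule.coe_sum, Submodule.coe_smul] at this
      exact this.symm
    rw [mul_apply_eq_comp, hx]
    simp [sum_apply]
  simp_rw [e]
  rw [← Finset.sum_const_zero (s := Finset.univ) (ι := Fin _)]
  refine tendsto_finsetSum _ fun j _ => ?_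
  rw [tendsto_zero_iff_norm_tendsto_zero]
  simp_rw [ContinuousLinearMap.norm_smulRight_apply]
  obtain ⟨x, hx⟩ := (b j).2
  have := (h x).norm.const_mul ‖φ j‖
  rw [norm_zero, mul_zero] at this
  have hx' : P x = b j := hx
  rwa [hx'] at this

theorem exists_mul_eq_of_finiteDimensional_range {B P : E →L[ℂ] E} (hB : Function.Injective B)
    (hfin : FiniteDimensional ℂ (LinearMap.range (P : E →ₗ[ℂ] E)))
    (h : ∀ x, ∃ v, B v = P x) : ∃ D : E →L[ℂ] E, B * D = P := by
  have hle : LinearMap.range (P : E →ₗ[ℂ] E) ≤ LinearMap.range (B : E →ₗ[ℂ] E) := by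
    rintro _ ⟨x, rfl⟩
    exact h x
  let e := LinearEquiv.ofInjective (B : E →ₗ[ℂ] E) hB
  let j : LinearMap.range (P : E →ₗ[ℂ] E) →ₗ[ℂ] E := e.symm.toLinearMap ∘ₗ Submodule.inclusion hle
  refine ⟨(LinearMap.toContinuousLinearMap j).comp P.rangeRestrict, ?_⟩
  ext x
  exact congrArg Subtype.val (e.apply_symm_apply (Submodule.inclusion hle (P.rangeRestrict x)))

/-- Multiplying by `e^{ict}` undoes the shift; the product rule adds `i c P x`, the source of the
term `-c P` in the generator. -/
theorem hasDerivAt_compression_of_shift {U : ℝ → E →L[ℂ] E} {P L : E →L[ℂ] E} {c : ℝ} {x : E}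
    (hU : U 0 = 1) (hx : P (P x) = P x)
    (h : HasDerivAt (fun t => (P * (Complex.exp (Complex.I * ↑(-c * t)) • U t) * P) x)
      (-Complex.I • L x) 0) :
    HasDerivAt (fun t => (P * U t * P) x) (-Complex.I • (L - (c : ℂ) • P) x) 0 := by
  have h2 : HasDerivAt (fun t : ℝ => Complex.exp (Complex.I * ↑(c * t))) (Complex.I * c) 0 := by
    have h3 : HasDerivAt (fun t : ℝ => c * t) c 0 := by
      simpa using (hasDerivAt_id (0 : ℝ)).const_mul c
    simpa using (h3.ofReal_comp.const_mul Complex.I).cexp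
  refine ((h2.smul h).congr_deriv ?_).congr_of_eventuallyEq (Eventually.of_forall fun t => ?_)
  · simp only [hU, mul_zero, Complex.ofReal_zero, Complex.exp_zero, one_smul, mul_one,
      mul_apply_eq_comp, hx, sub_apply, smul_apply]
    module
  · simp only [Pi.smul_apply', mul_smul_comm, smul_mul_assoc, smul_apply, smul_smul,
      ← Complex.exp_add]
    rw [← mul_add, ← Complex.ofReal_add]
    simp

theorem eventually_norm_compression_sub_le {F G : ℝ → E →L[ℂ] E} {P : E →L[ℂ] E}
    (hfin : FiniteDimensional ℂ (LinearMap.range (P : E →ₗ[ℂ] E))) {f' : E → E}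
    (h0 : F 0 * P = G 0 * P)
    (hF : ∀ x, HasDerivAt (fun t => F t (P x)) (f' x) 0)
    (hG : ∀ x, HasDerivAt (fun t => G t (P x)) (f' x) 0) {ε : ℝ} (hε : 0 < ε) :
    ∀ᶠ s in 𝓝 (0 : ℝ), ‖(F s - G s) * P‖ ≤ ε * |s| := by
  have hx : ∀ x, Tendsto (fun s : ℝ => ((s : ℂ)⁻¹ • (F s - G s)) (P x)) (𝓝[≠] 0) (𝓝 0) := by
    intro x
    have h1 := hasDerivAt_iff_tendsto_slope_zero.1 ((hF x).sub (hG x))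
    rw [sub_self] at h1
    refine h1.congr fun s => ?_
    have h2 : F 0 (P x) = G 0 (P x) := congrArg (fun T : E →L[ℂ] E => T x) h0
    simp only [zero_add, Pi.sub_apply, h2, sub_self, sub_zero, smul_apply, sub_apply]
    rw [← Complex.ofReal_inv, Complex.coe_smul]
  have h1 := tendsto_mul_of_finiteDimensional_range hfin hx
  have h2 := (tendsto_zero_iff_norm_tendsto_zero.1 h1).eventually (gt_mem_nhds hε)
  rw [eventually_nhdsWithin_iff] at h2
  filter_upwards [h2] with s hs
  rcases eq_or_ne s 0 with rfl | hs0
  · simp [sub_mul, h0]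
  · have := hs hs0
    rw [smul_mul_assoc, norm_smul, norm_inv, Complex.norm_real, Real.norm_eq_abs,
      inv_mul_lt_iff₀ (abs_pos.2 hs0)] at this
    linarith

section Complete

variable [CompleteSpace E]

theorem isUnitaryGroupOf_expNegI {A : E →ₗ.[ℂ] E} (h : ∃ U, IsUnitaryGroupOf A U) :
    IsUnitaryGroupOf A (expNegI A) := by
  rw [expNegI, dif_pos h]
  exact h.choose_spec

namespace IsUnitaryGroupOf

variable {A : E →ₗ.[ℂ] E} {U : ℝ → E →L[ℂ] E}

theorem norm_le_one (h : IsUnitaryGroupOf A U) (t : ℝ) : ‖U t‖ ≤ 1 := by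
  have h1 : star (U t) * U t = 1 := (Unitary.mem_iff.1 (h.mem_unitary t)).1
  have h2 : ‖U t‖ * ‖U t‖ ≤ 1 := by
    rw [← CStarRing.norm_star_mul_self, h1]
    exact ContinuousLinearMap.norm_id_le
  nlinarith [norm_nonneg (U t)]

theorem pow_div (h : IsUnitaryGroupOf A U) (t : ℝ) {n : ℕ} (hn : n ≠ 0) :
    U (t / n) ^ n = U t := by
  have hmul : ∀ k : ℕ, U (k * (t / n)) = U (t / n) ^ k := by
    intro k
    induction k with
    | zero => simp [h.map_zero]
    | succ k ih =>
      rw [pow_succ, ← ih, ← h.map_add]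
      congr 1
      push_cast
      ring
  rw [← hmul]
  congr 1
  field_simp

/-- `U s` commutes with every `U t`, so it preserves the graph of the generator, and therefore
commutes with the resolvent. -/
theorem commute_resolvent (h : IsUnitaryGroupOf A U) {R : E →L[ℂ] E} (hR : IsPosResolvent A R)
    (s : ℝ) : Commute R (U s) := by
  ext x
  have hd := (h.mem_graph_iff _ _).1 (hR.apply_mem_graph x)
  have hd' : HasDerivAt (fun t => U t (U s (R x))) (-Complex.I • U s ((1 - R) x)) 0 := by
    have := ((U s).restrictScalars ℝ).hasFDerivAt.comp_hasDerivAt 0 hd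
    refine (this.congr_deriv ?_).congr_of_eventuallyEq (Eventually.of_forall fun t => ?_)
    · simp
    · change (U t * U s) (R x) = (U s * U t) (R x)
      rw [← h.map_add, ← h.map_add, add_comm]
  have := (hR.mem_graph_iff _ _).1 ((h.mem_graph_iff _ _).2 hd')
  rw [← (U s).map_add, sub_apply, one_apply_eq_self, add_sub_cancel] at this
  exact this

end IsUnitaryGroupOf

theorem hasDerivAt_compression {A : E →ₗ.[ℂ] E} {V : ℝ → E →L[ℂ] E} (hV : IsUnitaryGroupOf A V)
    {R : E →L[ℂ] E} (hR : IsPosResolvent A R) {P D : E →L[ℂ] E} (hP : IsSelfAdjoint P)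
    (hD : CFC.sqrt R * D = P) (x : E) :
    HasDerivAt (fun t => (P * V t * P) x)
      (-Complex.I • (star (CFC.sqrt (1 - R) * D) * (CFC.sqrt (1 - R) * D)) x) 0 := by
  have hB : ∀ T : E →L[ℂ] E, star (CFC.sqrt T) = CFC.sqrt T := fun T =>
    (IsPosResolvent.isSelfAdjoint_sqrt T).star_eq
  have hD' : star D * CFC.sqrt R = P := by
    rw [← hP.star_eq, ← hD, star_mul, hB]
  have e : ∀ t, P * V t * P = star D * (V t * (R * D)) := fun t => by
    have h1 : CFC.sqrt R * V t = V t * CFC.sqrt R := (hV.commute_resolvent hR t).cfc_sqrt.eq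
    calc P * V t * P = star D * CFC.sqrt R * V t * (CFC.sqrt R * D) := by rw [hD', hD]
      _ = star D * (CFC.sqrt R * V t) * (CFC.sqrt R * D) := by simp only [mul_assoc]
      _ = star D * (V t * ((CFC.sqrt R * CFC.sqrt R) * D)) := by rw [h1]; simp only [mul_assoc]
      _ = _ := by rw [hR.sqrt_mul_sqrt]
  have e2 : star (CFC.sqrt (1 - R) * D) * (CFC.sqrt (1 - R) * D) = star D * ((1 - R) * D) := by
    rw [star_mul, hB, mul_assoc, ← mul_assoc (CFC.sqrt (1 - R)),
      hR.sqrt_one_sub_mul_sqrt_one_sub]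
  rw [e2]
  simp_rw [e]
  have hd := (hV.mem_graph_iff _ _).1 (hR.apply_mem_graph (D x))
  have := ((star D).restrictScalars ℝ).hasFDerivAt.comp_hasDerivAt 0 hd
  exact this.congr_deriv (by simp)

theorem zenoGenerator_eq {H : E →ₗ.[ℂ] E} {c : ℝ} {R : E →L[ℂ] E}
    (hR : IsPosResolvent (shift c H) R) {P D : E →L[ℂ] E} (hD : CFC.sqrt R * D = P) :
    zenoGenerator H c P =
      ((star (CFC.sqrt (1 - R) * D) * (CFC.sqrt (1 - R) * D) - (c : ℂ) • P : E →L[ℂ] E) :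
        E →ₗ[ℂ] E).toPMap ⊤ := by
  have hT : sqrtComp H c P = ((CFC.sqrt (1 - R) * D : E →L[ℂ] E) : E →ₗ[ℂ] E).toPMap ⊤ := by
    apply LinearPMap.eq_of_eq_graph
    ext ⟨x, z⟩
    rw [sqrtComp, mem_graph_opComp, hR.sqrtOp_eq, mem_graph_toPMap_top]
    simp only [mem_graph_toPMap_top, hR.mem_graph_sqrtOfResolvent, exists_eq_left']
    constructor
    · rintro ⟨v, hv, rfl⟩
      -- Injectivity of `R^{1/2}` forces `v = D x`, so `(H + c)^{1/2} P` is the everywhere defined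
      -- bounded operator `(1 - R)^{1/2} D`.
      have : v = D x := hR.injective_sqrt (by rw [hv, ← hD]; rfl)
      rw [this]
      rfl
    · rintro rfl
      exact ⟨D x, by rw [← hD]; rfl, rfl⟩
  apply LinearPMap.eq_of_eq_graph
  ext ⟨x, y⟩
  rw [zenoGenerator, hT,
    ContinuousLinearMap.toPMap_adjoint_eq_adjoint_toPMap_of_dense _ (by simp), mem_graph_vadd,
    mem_graph_opComp, mem_graph_toPMap_top]
  simp only [mem_graph_toPMap_top, exists_eq_left', ContinuousLinearMap.star_eq_adjoint]
  generalize CFC.sqrt (1 - R) * D = M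
  simp [sub_eq_iff_eq_add]

/-- A Chernoff product formula on a finite-dimensional subspace. -/
theorem tendstoUniformlyOn_pow {A : E →ₗ.[ℂ] E} {F G : ℝ → E →L[ℂ] E} (hG : IsUnitaryGroupOf A G)
    {P : E →L[ℂ] E} (hP : IsIdempotentElem P)
    (hF : ∀ t, ‖F t‖ ≤ 1) (hPF : ∀ t, P * F t = F t) (hFP : ∀ t, F t * P = F t)
    (hFG : ∀ ε > 0, ∀ᶠ s in 𝓝 (0 : ℝ), ‖(F s - G s) * P‖ ≤ ε * |s|) (ψ : E) {a b : ℝ}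
    (ha : 0 ≤ a) :
    TendstoUniformlyOn (fun (n : ℕ) (t : ℝ) => (F (t / n) ^ n) ψ) (fun t => G t (P ψ))
      atTop (Set.Icc a b) := by
  rw [Metric.tendstoUniformlyOn_iff]
  intro ε hε
  -- Dominates `t * ‖P ψ‖` on the interval; the added ones keep it positive when `b` or `P ψ`
  -- vanishes.
  have hM : 0 < (|b| + 1) * (‖P ψ‖ + 1) := by positivity
  obtain ⟨δ, hδ, hs⟩ := Metric.eventually_nhds_iff.1
    (hFG (ε / 2 / ((|b| + 1) * (‖P ψ‖ + 1))) (by positivity))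
  have hlim : Tendsto (fun n : ℕ => |b| / n) atTop (𝓝 0) :=
    tendsto_const_div_atTop_nhds_zero_nat _
  filter_upwards [hlim.eventually (gt_mem_nhds hδ), eventually_ne_atTop 0] with n hn hn0 t ht
  have ht0 : 0 ≤ t := ha.trans ht.1
  have htb : t ≤ |b| := ht.2.trans (le_abs_self b)
  have hnpos : (0 : ℝ) < n := by exact_mod_cast Nat.pos_of_ne_zero hn0
  have h1 : ‖(F (t / n) - G (t / n)) * P‖ ≤ ε / 2 / ((|b| + 1) * (‖P ψ‖ + 1)) * |t / n| := by
    apply hs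
    rw [dist_zero_right, Real.norm_eq_abs, abs_of_nonneg (div_nonneg ht0 hnpos.le)]
    exact (div_le_div_of_nonneg_right htb hnpos.le).trans_lt hn
  rw [abs_of_nonneg (div_nonneg ht0 hnpos.le)] at h1
  have hP' : P (P ψ) = P ψ := congrArg (fun T : E →L[ℂ] E => T ψ) hP.eq
  have h2 := norm_pow_sub_pow_apply_le (hF (t / n)) (hG.norm_le_one (t / n)) (hPF (t / n)) hP' n
  -- Needs `n ≠ 0`: the last factor absorbs `P`, whereas `F ^ 0` would return `ψ` itself.
  have h3 : (F (t / n) ^ n) (P ψ) = (F (t / n) ^ n) ψ := by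
    obtain ⟨k, rfl⟩ := Nat.exists_eq_succ_of_ne_zero hn0
    rw [pow_succ]
    exact congrArg (fun T : E →L[ℂ] E => (F (t / (k.succ : ℕ)) ^ k) (T ψ)) (hFP _)
  rw [hG.pow_div t hn0, h3] at h2
  rw [dist_comm, dist_eq_norm]
  refine h2.trans_lt ?_
  calc n * ‖(F (t / n) - G (t / n)) * P‖ * ‖P ψ‖
      ≤ n * (ε / 2 / ((|b| + 1) * (‖P ψ‖ + 1)) * (t / n)) * ‖P ψ‖ := by gcongr
    _ = ε / 2 * ((t * ‖P ψ‖) / ((|b| + 1) * (‖P ψ‖ + 1))) := by field_simp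
    _ ≤ ε / 2 * 1 := by
        gcongr
        rw [div_le_one hM]
        gcongr <;> linarith
    _ < ε := by linarith

end Complete

end ZenoDynamics

theorem theorem2p2 {E : Type*} [NormedAddCommGroup E] [InnerProductSpace ℂ E] [CompleteSpace E]
    [TopologicalSpace.SeparableSpace E]
    (H : E →ₗ.[ℂ] E) (hH : IsSelfAdjoint H)
    (c : ℝ) (hc : ZenoDynamics.IsBoundedBelow H c)
    (P : E →L[ℂ] E) (hP : IsStarProjection P)
    (hfin : FiniteDimensional ℂ (LinearMap.range (P : E →ₗ[ℂ] E)))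
    (hform : ∀ x : E, P x ∈ ZenoDynamics.formDomain H c) (ψ : E) :
    (∀ t : ℝ, 0 ≤ t →
      Tendsto
        (fun n : ℕ => ((P * ZenoDynamics.expNegI H (t / n) * P) ^ n) ψ) atTop
        (𝓝 (ZenoDynamics.expNegI (ZenoDynamics.zenoGenerator H c P) t (P ψ)))) ∧
    (∀ a b : ℝ, 0 ≤ a →
      TendstoUniformlyOn
        (fun (n : ℕ) (t : ℝ) => ((P * ZenoDynamics.expNegI H (t / n) * P) ^ n) ψ)
        (fun t : ℝ => ZenoDynamics.expNegI (ZenoDynamics.zenoGenerator H c P) t (P ψ))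
        atTop (Set.Icc a b)) := by
  open ZenoDynamics in
  obtain ⟨R, hR⟩ := exists_isPosResolvent (isSelfAdjoint_shift hH c) fun x y => shift_nonneg hc
  -- The form domain is the range of `R^{1/2}`, so the hypothesis on `P` factors it as `P = R^{1/2}
  -- D`.
  obtain ⟨D, hD⟩ := exists_mul_eq_of_finiteDimensional_range hR.injective_sqrt hfin fun x => by
    have := hform x
    rw [formDomain, hR.sqrtOp_eq, LinearPMap.mem_domain_iff] at this
    obtain ⟨y, hy⟩ := this
    obtain ⟨v, hv, -⟩ := hR.mem_graph_sqrtOfResolvent.1 hy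
    exact ⟨v, hv⟩
  have hU : IsUnitaryGroupOf H (expNegI H) :=
    isUnitaryGroupOf_expNegI (exists_isUnitaryGroupOf hH hc)
  have hV := hU.shift c
  set L : E →L[ℂ] E := star (CFC.sqrt (1 - R) * D) * (CFC.sqrt (1 - R) * D)
  have hgen : zenoGenerator H c P = ((L - (c : ℂ) • P : E →L[ℂ] E) : E →ₗ[ℂ] E).toPMap ⊤ :=
    zenoGenerator_eq hR hD
  have hK : IsSelfAdjoint (L - (c : ℂ) • P) :=
    (IsSelfAdjoint.star_mul_self _).sub
      (IsSelfAdjoint.smul (by simp [IsSelfAdjoint]) hP.isSelfAdjoint)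
  rw [hgen]
  have hG := isUnitaryGroupOf_expNegI (exists_isUnitaryGroupOf_toPMap hK)
  have hPP : P * P = P := hP.isIdempotentElem.eq
  have hPn : ‖P‖ ≤ 1 := hP.norm_le
  have hFd : ∀ x, HasDerivAt (fun t => (P * expNegI H t * P) (P x))
      (-Complex.I • (L - (c : ℂ) • P) (P x)) 0 := fun x => by
    have hx : ∀ y, P (P y) = P y := fun y => congrArg (fun T : E →L[ℂ] E => T y) hPP
    have := hasDerivAt_compression_of_shift hU.map_zero (hx (P x))
      (hasDerivAt_compression hV hR hP.isSelfAdjoint hD (P x))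
    exact this
  have hGd : ∀ x, HasDerivAt
      (fun t => expNegI (((L - (c : ℂ) • P : E →L[ℂ] E) : E →ₗ[ℂ] E).toPMap ⊤) t (P x))
      (-Complex.I • (L - (c : ℂ) • P) (P x)) 0 := fun x =>
    (hG.mem_graph_iff _ _).1 (mem_graph_toPMap_top.2 rfl)
  have hunif : ∀ a b : ℝ, 0 ≤ a → TendstoUniformlyOn
      (fun (n : ℕ) (t : ℝ) => ((P * expNegI H (t / n) * P) ^ n) ψ)
      (fun t : ℝ => expNegI (((L - (c : ℂ) • P : E →L[ℂ] E) : E →ₗ[ℂ] E).toPMap ⊤) t (P ψ))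
      atTop (Set.Icc a b) := fun a b ha => by
    refine tendstoUniformlyOn_pow (F := fun t => P * expNegI H t * P) hG hP.isIdempotentElem
      (fun t => ?_) (fun t => ?_) (fun t => ?_) (fun ε hε => ?_) ψ ha
    · refine (norm_mul_le _ _).trans (mul_le_one₀ ((norm_mul_le _ _).trans ?_) (norm_nonneg _) hPn)
      exact mul_le_one₀ hPn (norm_nonneg _) (hU.norm_le_one t)
    · rw [← mul_assoc, ← mul_assoc, hPP]
    · rw [mul_assoc, hPP]
    · refine eventually_norm_compression_sub_le hfin ?_ hFd hGd hε
      -- At time 0 the two families are `P` and `1`, equal on the range of `P`.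
      rw [hG.map_zero, hU.map_zero, mul_one, hPP, hPP, one_mul]
  refine ⟨fun t ht => ?_, hunif⟩
  -- Pointwise convergence is the case of the degenerate interval `[t, t]`.
  exact (hunif t t ht).tendsto_at (Set.mem_Icc.2 ⟨le_rfl, le_rfl⟩)
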